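/- Let $A,B$ be finite sets. We say that $A$ splits $B$ if $|A\cap B|=|B|/2$ when $|B|$ is even, and $|A\cap B|\in\{(|B|-1)/2,\,(|B|+1)/2\}$ when $|B|$ is odd. For integers $m,n\ge 2$, $m\times n$ splitting tic-tac-toe is the following game. Two players, Split and Skew, alternately claim unclaimed cells of an $m\times n$ grid until all $mn$ cells have been claimed; either player may be designated to move first (Player I), and the other is Player II. Split wins if the set of cells that she has claimed splits every row and every column of the grid; otherwise Skew wins. **Theorem.** Let $m,n\ge 2$. - If $m=n=3$, then Player II has a winning strategy, whichever of Split and Skew is Player II. - Otherwise, Skew has a winning strategy, whichever of Split and Skew moves first. -/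

import Mathlib

namespace SplittingGame

/-- `A` splits `B`: `|A ∩ B| = |B| / 2` for `|B|` even, and `|A ∩ B| = (|B| ± 1) / 2` for `|B|` odd
(the divisions are cleared). -/
def Splits {α : Type*} [DecidableEq α] (A B : Finset α) : Prop :=
  (Even B.card → 2 * (A ∩ B).card = B.card) ∧
  (Odd B.card → 2 * (A ∩ B).card = B.card + 1 ∨ 2 * (A ∩ B).card + 1 = B.card)

/-- The two players. -/
inductive Player where
  | split : Player
  | skew : Player
deriving DecidableEq

/-- The opponent of a player. -/
def Player.other : Player → Player
  | .split => .skew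
  | .skew => .split

/-- The player who makes move number `i` (counted from `0`) when `t` moves first. -/
def mover (t : Player) (i : ℕ) : Player :=
  if Even i then t else t.other

/-- The elements claimed by player `p` in the sequence of moves `l` (earliest move first),
when `t` makes the first move of `l`. -/
def claimed {α : Type*} [DecidableEq α] (p : Player) : Player → List α → Finset α
  | _, [] => ∅
  | t, x :: l => if t = p then insert x (claimed p t.other l) else claimed p t.other l

/-- A complete run of the game on the ground set `α`: every element is claimed exactly once. -/
def IsRun {α : Type*} (l : List α) : Prop :=
  l.Nodup ∧ ∀ x : α, x ∈ l

/-- Player `p` wins the complete run `l` on the board `𝓑` when `t` moves first: Split wins if the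
set of elements that she claimed splits every set of the board, and Skew wins otherwise. -/
def Wins {α : Type*} [DecidableEq α] (𝓑 : Finset (Finset α)) (t : Player) (l : List α) :
    Player → Prop
  | .split => ∀ B ∈ 𝓑, Splits (claimed .split t l) B
  | .skew => ¬ ∀ B ∈ 𝓑, Splits (claimed .split t l) B

/-- A map `σ` from histories to moves is a legal strategy for player `p` when `t` moves first: in
every history without repetition in which `p` is to move and some element is still unclaimed, `σ`
selects an unclaimed element. -/
def IsStrategy {α : Type*} (t p : Player) (σ : List α → α) : Prop :=
  ∀ h : List α, h.Nodup → mover t h.length = p → (∃ x : α, x ∉ h) → σ h ∉ h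

/-- In the run `l`, in which `t` moves first, every move of player `p` is the one given by `σ`. -/
def Follows {α : Type*} (t p : Player) (σ : List α → α) (l : List α) : Prop :=
  ∀ (i : ℕ) (hi : i < l.length), mover t i = p → l[i] = σ (l.take i)

/-- Player `p` has a winning strategy in the splitting game on the board `𝓑` of subsets of the
nonempty finite set `α` when `t` moves first. -/
def HasWinningStrategy {α : Type*} [DecidableEq α] (𝓑 : Finset (Finset α)) (t p : Player) :
    Prop :=
  ∃ σ : List α → α, IsStrategy t p σ ∧
    ∀ l : List α, IsRun l → Follows t p σ l → Wins 𝓑 t l p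

/-- The row with index `i` of the `m × n` grid. -/
def row (m n : ℕ) (i : Fin m) : Finset (Fin m × Fin n) :=
  Finset.univ.filter fun x => x.1 = i

/-- The column with index `j` of the `m × n` grid. -/
def column (m n : ℕ) (j : Fin n) : Finset (Fin m × Fin n) :=
  Finset.univ.filter fun x => x.2 = j

/-- The board of `m × n` splitting tic-tac-toe: the rows and the columns of the `m × n` grid. -/
def ticTacToeBoard (m n : ℕ) : Finset (Finset (Fin m × Fin n)) :=
  Finset.univ.image (row m n) ∪ Finset.univ.image (column m n)

end SplittingGame

/-!
A position is summarized on each row and column by its *imbalance*, the number of Split's elements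
minus the number of Skew's; Split wins if all final imbalances are at most `1` in absolute value.
For a line of even size put `e = 0`, for one of odd size `e = 1`. With Skew to move, a line with
imbalance below `-e` is won for Skew, who keeps playing in it (`skewForces_of_low`), and so is a
line with imbalance above `1 + e`, which he leaves to Split as long as he can
(`skewForces_of_high`). Hence a free cell both of whose lines have imbalance at most `-e` is a
double threat (`skewForces_of_double`).

These facts decide the game within a few moves, on a few rows and columns of the board. A
*summary* records the imbalances of these lines and which of their crossings are free; moves of
Split elsewhere only change the imbalance of one line, or of none, so that a finite search on
summaries covers boards of every size (`Summarizes.skewForces_of_skewSearch`). Moving first, Skew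
wins
* at once, if all lines have even size;
* on two rows and one column, if rows have even size and columns have odd size: he takes a cell of
  the column, Split must answer in its row, and the next cell of the column is a double threat;
* on four rows and three columns, if all lines have odd size.

Avoiding the row and the column of Split's first move, he wins as second player if one more row
and one more column are available (`LineGrid.skewForces`). What remains, up to exchanging rows and
columns, is Split's first move on a board with three columns and an odd number of rows. If there
are three rows, the search covers the whole board; otherwise it uses five of the rows, with
Split's move in one of them. On the `3 × 3` board with Skew moving first, a search of the whole
game shows that Split wins.
-/

namespace SplittingGame

/-! ### Positions and forced wins -/

/-- A position of the game: the owner of each element of the ground set, `none` if it is still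
unclaimed. -/
abbrev Position (α : Type*) := α → Option Player

lemma mover_zero (t : Player) : mover t 0 = t := by simp [mover]

lemma mover_other (t : Player) (i : ℕ) : mover t.other i = mover t (i + 1) := by
  cases t <;> by_cases h : Even i <;> simp [mover, h, Nat.even_add_one, Player.other]

lemma mover_succ (t : Player) (i : ℕ) : mover t (i + 1) = (mover t i).other := by
  cases t <;> by_cases h : Even i <;> simp [mover, h, Nat.even_add_one, Player.other]

section Positions

variable {α : Type*} [DecidableEq α]

lemma claimed_subset (p t : Player) (h : List α) : claimed p t h ⊆ h.toFinset := by
  induction h generalizing t with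
  | nil => simp [claimed]
  | cons x l ih =>
    have := ih t.other
    simp only [claimed, List.toFinset_cons]
    split_ifs
    · exact Finset.insert_subset_insert _ this
    · exact this.trans (Finset.subset_insert _ _)

lemma claimed_append_singleton (p t : Player) (h : List α) (x : α) :
    claimed p t (h ++ [x]) =
      if mover t h.length = p then insert x (claimed p t h) else claimed p t h := by
  induction h generalizing t with
  | nil => simp [claimed, mover_zero]
  | cons y l ih =>
    simp only [List.cons_append, claimed, ih, List.length_cons, mover_other]
    split_ifs <;> simp [Finset.insert_comm]

/-- The position reached by the history `h` when `t` moves first. -/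
def positionOf (t : Player) (h : List α) : Position α := fun x =>
  if x ∈ claimed .split t h then some .split
  else if x ∈ claimed .skew t h then some .skew else none

lemma positionOf_nil (t : Player) : positionOf t ([] : List α) = fun _ => none := by
  funext x
  simp [positionOf, claimed]

lemma positionOf_append_singleton (t : Player) {h : List α} {x : α} (hx : x ∉ h) :
    positionOf t (h ++ [x]) = Function.update (positionOf t h) x (some (mover t h.length)) := by
  have hx' (p : Player) : x ∉ claimed p t h := fun hc => hx (by
    simpa using claimed_subset p t h hc)
  funext y
  simp only [positionOf, claimed_append_singleton]
  by_cases hy : y = x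
  · subst hy
    cases hm : mover t h.length <;> simp [hx']
  · cases hm : mover t h.length <;> simp [hy, positionOf]

lemma positionOf_eq_none_iff (t : Player) (h : List α) (hn : h.Nodup) (x : α) :
    positionOf t h x = none ↔ x ∉ h := by
  induction h using List.reverseRecOn with
  | nil => simp [positionOf_nil]
  | append_singleton l y ih =>
    rw [List.nodup_append] at hn
    have hy : y ∉ l := fun hy => hn.2.2 y hy y (by simp) rfl
    rw [positionOf_append_singleton t hy]
    by_cases hxy : x = y
    · simp [hxy]
    · simp [hxy, ih hn.1]

/-- `Forces p W q f`: in the position `f` with `q` to move, player `p` can force the game to end in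
a complete position satisfying `W`. -/
inductive Forces (p : Player) (W : Position α → Prop) : Player → Position α → Prop
  | done {q : Player} {f : Position α} (hf : ∀ x, f x ≠ none) (hW : W f) : Forces p W q f
  | own {f : Position α} (x : α) (hx : f x = none)
      (h : Forces p W p.other (Function.update f x (some p))) : Forces p W p f
  | opp {f : Position α} (hf : ∃ x, f x = none)
      (h : ∀ x, f x = none → Forces p W p (Function.update f x (some p.other))) :
      Forces p W p.other f

lemma Player.other_ne (p : Player) : p.other ≠ p := by cases p <;> simp [Player.other]

lemma Player.other_other (p : Player) : p.other.other = p := by cases p <;> rfl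

lemma Player.eq_other_of_ne {p q : Player} (h : q ≠ p) : q = p.other := by
  cases p <;> cases q <;> simp_all [Player.other]

lemma Forces.exists_move {p : Player} {W : Position α → Prop} {f : Position α}
    (h : Forces p W p f) (hf : ∃ x, f x = none) :
    ∃ x, f x = none ∧ Forces p W p.other (Function.update f x (some p)) := by
  obtain ⟨q, hq⟩ : ∃ q, q = p := ⟨p, rfl⟩
  have h' : Forces p W q f := hq ▸ h
  cases h' with
  | done hf' _ => exact absurd hf (by simpa using hf')
  | own x hx h => exact ⟨x, hx, h⟩
  | opp _ _ => exact absurd hq p.other_ne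

lemma Forces.of_reply {p : Player} {W : Position α → Prop} {f : Position α}
    (h : Forces p W p.other f) {x : α} (hx : f x = none) :
    Forces p W p (Function.update f x (some p.other)) := by
  generalize hq : p.other = q at h
  cases h with
  | done hf' _ => exact absurd hx (hf' x)
  | own _ _ _ => exact absurd hq p.other_ne
  | opp _ h => exact h x hx

lemma Forces.of_complete {p q : Player} {W : Position α → Prop} {f : Position α}
    (h : Forces p W q f) (hf : ∀ x, f x ≠ none) : W f := by
  cases h with
  | done _ hW => exact hW
  | own x hx _ => exact absurd hx (hf x)
  | opp hx _ => exact absurd hx (by simpa using hf)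

/-- A forced win from the empty position is a winning strategy: the strategy always moves to a
position in which the win is still forced. -/
lemma hasWinningStrategy_of_forces [Nonempty α] {𝓑 : Finset (Finset α)} {t p : Player}
    {W : Position α → Prop} (hW : ∀ l : List α, IsRun l → W (positionOf t l) → Wins 𝓑 t l p)
    (h : Forces p W t fun _ => none) : HasWinningStrategy 𝓑 t p := by
  classical
  let good (l : List α) (x : α) : Prop :=
    x ∉ l ∧ Forces p W p.other (Function.update (positionOf t l) x (some p))
  let σ (l : List α) : α :=
    if hg : ∃ x, good l x then hg.choose
    else if hl : ∃ x, x ∉ l then hl.choose else Classical.arbitrary α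
  refine ⟨σ, ?_, ?_⟩
  · intro l _ _ hl
    simp only [σ]
    split_ifs with hg
    · exact hg.choose_spec.1
    · exact hl.choose_spec
  · intro l hl hfol
    have key : ∀ i ≤ l.length, Forces p W (mover t i) (positionOf t (l.take i)) := by
      intro i
      induction i with
      | zero => intro _; simpa [positionOf_nil, mover_zero] using h
      | succ i ih =>
        intro hi
        have hi' : i < l.length := hi
        have ih := ih hi'.le
        have hnd : (l.take i).Nodup := hl.1.sublist (List.take_sublist _ _)
        have hlen : (l.take i).length = i := by simp [hi'.le]
        have hfresh : l[i] ∉ l.take i := by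
          have := hl.1.sublist (List.take_sublist (i + 1) l)
          rw [List.take_succ_eq_append_getElem hi', List.nodup_append] at this
          exact fun hmem => this.2.2 _ hmem _ (by simp) rfl
        have hfree := (positionOf_eq_none_iff t _ hnd l[i]).2 hfresh
        rw [List.take_succ_eq_append_getElem hi', positionOf_append_singleton t hfresh, hlen,
          mover_succ]
        by_cases hm : mover t i = p
        · rw [hm] at ih ⊢
          obtain ⟨x, hx, hxF⟩ := ih.exists_move ⟨_, hfree⟩
          have hg : ∃ x, good (l.take i) x :=
            ⟨x, (positionOf_eq_none_iff t _ hnd x).1 hx, hxF⟩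
          have hσ : l[i] = hg.choose := by
            rw [hfol i hi' hm]
            simp only [σ, dif_pos hg]
          have := hg.choose_spec.2
          rwa [← hσ] at this
        · have hm := Player.eq_other_of_ne hm
          rw [hm] at ih ⊢
          rw [Player.other_other]
          exact ih.of_reply hfree
    have hfin := key l.length le_rfl
    rw [List.take_length] at hfin
    refine hW l hl (hfin.of_complete fun x hx => ?_)
    exact (positionOf_eq_none_iff t l hl.1 x).1 hx (hl.2 x)

end Positions

/-! ### Imbalance of a set in a position -/

/-- The contribution of an element to the imbalance: `1` if Split owns it, `-1` if Skew does. -/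
def charge : Option Player → ℤ
  | none => 0
  | some .split => 1
  | some .skew => -1

/-- The number of elements of `L` owned by Split minus the number owned by Skew. -/
def imbalance {α : Type*} (f : Position α) (L : Finset α) : ℤ := ∑ x ∈ L, charge (f x)

/-- The number of unclaimed elements of `L`. -/
def freeCount {α : Type*} (f : Position α) (L : Finset α) : ℕ := (L.filter fun x => f x = none).card

lemma freeCount_pos_iff {α : Type*} {f : Position α} {L : Finset α} :
    0 < freeCount f L ↔ ∃ x ∈ L, f x = none := by
  simp [freeCount, Finset.card_pos, Finset.Nonempty]

lemma freeCount_eq_zero {α : Type*} {f : Position α} {L : Finset α}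
    (hf : ¬ ∃ x, f x = none) : freeCount f L = 0 := by
  by_contra h
  obtain ⟨x, -, hx⟩ := freeCount_pos_iff.1 (Nat.pos_of_ne_zero h)
  exact hf ⟨x, hx⟩

lemma two_dvd_card_sub {α : Type*} (f : Position α) (L : Finset α) :
    (2 : ℤ) ∣ L.card - freeCount f L - imbalance f L := by
  have : (L.card : ℤ) - freeCount f L - imbalance f L =
      ∑ x ∈ L, (1 - (if f x = none then 1 else 0) - charge (f x)) := by
    simp [freeCount, imbalance, Finset.sum_sub_distrib]
  rw [this]
  refine Finset.dvd_sum fun x _ => ?_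
  rcases f x with _ | _ | _ <;> simp [charge]

section Imbalance

variable {α : Type*} [DecidableEq α]

lemma imbalance_update {f : Position α} {x : α} (hx : f x = none) (L : Finset α) (q : Player) :
    imbalance (Function.update f x (some q)) L =
      imbalance f L + if x ∈ L then charge (some q) else 0 := by
  have : ∀ y, charge (Function.update f x (some q) y) =
      charge (f y) + if x = y then charge (some q) else 0 := by
    intro y
    by_cases hy : y = x
    · subst hy; simp [hx, charge]
    · simp [hy, Ne.symm hy]
  simp only [imbalance, this, Finset.sum_add_distrib, Finset.sum_ite_eq]

lemma freeCount_update {f : Position α} {x : α} (hx : f x = none) (L : Finset α) (q : Player) :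
    freeCount (Function.update f x (some q)) L + (if x ∈ L then 1 else 0) = freeCount f L := by
  have : (L.filter fun y => Function.update f x (some q) y = none) =
      (L.filter fun y => f y = none).erase x := by
    ext y
    by_cases hy : y = x <;> simp [hy, and_comm]
  rw [freeCount, freeCount, this]
  split_ifs with h
  · exact Finset.card_erase_add_one (by simp [h, hx])
  · rw [Finset.erase_eq_of_notMem (by simp [h]), add_zero]

/-- The condition on complete positions that Split aims for. -/
def Balanced (𝓑 : Finset (Finset α)) (f : Position α) : Prop := ∀ L ∈ 𝓑, |imbalance f L| ≤ 1

lemma imbalance_positionOf (t : Player) {l : List α} (hl : IsRun l) (L : Finset α) :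
    imbalance (positionOf t l) L = 2 * (claimed .split t l ∩ L).card - L.card := by
  have : ∀ x, charge (positionOf t l x) = 2 * (if x ∈ claimed .split t l then 1 else 0) - 1 := by
    intro x
    have hx := (positionOf_eq_none_iff t l hl.1 x).not.2 (by simpa using hl.2 x)
    unfold positionOf at hx ⊢
    split_ifs at hx ⊢ <;> simp_all [charge]
  simp only [imbalance, this, Finset.sum_sub_distrib, ← Finset.mul_sum, Finset.sum_boole,
    Finset.filter_mem_eq_inter, Finset.sum_const, nsmul_eq_mul, mul_one, Finset.inter_comm]

lemma splits_iff (t : Player) {l : List α} (hl : IsRun l) (L : Finset α) :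
    Splits (claimed .split t l) L ↔ |imbalance (positionOf t l) L| ≤ 1 := by
  rw [imbalance_positionOf t hl, Splits, abs_le]
  rcases Nat.even_or_odd L.card with h | h
  · simp only [h, Nat.not_odd_iff_even.2 h, forall_const, IsEmpty.forall_iff, and_true]
    obtain ⟨k, hk⟩ := h
    omega
  · simp only [h, Nat.not_even_iff_odd.2 h, forall_const, IsEmpty.forall_iff, true_and]
    obtain ⟨k, hk⟩ := h
    omega

lemma hasWinningStrategy_skew [Nonempty α] {𝓑 : Finset (Finset α)} {t : Player}
    (h : Forces .skew (fun f => ¬ Balanced 𝓑 f) t fun _ => none) :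
    HasWinningStrategy 𝓑 t .skew :=
  hasWinningStrategy_of_forces
    (fun _ hl hW hs => hW fun L hL => (splits_iff t hl L).1 (hs L hL)) h

lemma hasWinningStrategy_split [Nonempty α] {𝓑 : Finset (Finset α)} {t : Player}
    (h : Forces .split (Balanced 𝓑) t fun _ => none) :
    HasWinningStrategy 𝓑 t .split :=
  hasWinningStrategy_of_forces (fun _ hl hW L hL => (splits_iff t hl L).2 (hW L hL)) h

end Imbalance

/-! ### Lines and cells that decide the game for Skew -/

section Decided

variable {α : Type*} [DecidableEq α] {𝓑 : Finset (Finset α)} {f : Position α} {L M : Finset α}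

/-- With `q` to move, Skew can force some set of the board not to be split. -/
abbrev SkewForces (𝓑 : Finset (Finset α)) (q : Player) (f : Position α) : Prop :=
  Forces .skew (fun f => ¬ Balanced 𝓑 f) q f

lemma SkewForces.move {x : α} (hx : f x = none)
    (h : SkewForces 𝓑 .split (Function.update f x (some .skew))) : SkewForces 𝓑 .skew f :=
  Forces.own x hx h

lemma SkewForces.of_replies (hf : ∃ x, f x = none)
    (h : ∀ x, f x = none → SkewForces 𝓑 .skew (Function.update f x (some .split))) :
    SkewForces 𝓑 .split f :=
  Forces.opp (p := .skew) hf h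

lemma SkewForces.of_complete {q : Player} (hL : L ∈ 𝓑) (hf : ¬ ∃ x, f x = none)
    (h : imbalance f L ≤ -2 ∨ 2 ≤ imbalance f L) : SkewForces 𝓑 q f :=
  Forces.done (by simpa using hf) fun hb => by
    have := abs_le.1 (hb L hL)
    omega

variable [Fintype α]

lemma freeCount_univ_update {x : α} (hx : f x = none) (q : Player) :
    freeCount (Function.update f x (some q)) Finset.univ + 1 = freeCount f Finset.univ := by
  simpa using freeCount_update hx Finset.univ q

/-- If Skew's surplus in `L` is at least two even after the remaining elements of `L` are shared
alternately, beginning with the player to move, then playing in `L` as long as possible keeps it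
so. -/
lemma skewForces_of_deficit (hL : L ∈ 𝓑) (f : Position α) :
    (imbalance f L - (freeCount f L % 2 : ℕ) ≤ -2 → SkewForces 𝓑 .skew f) ∧
      (imbalance f L + (freeCount f L % 2 : ℕ) ≤ -2 → SkewForces 𝓑 .split f) := by
  induction hN : freeCount f Finset.univ generalizing f with
  | zero =>
    have hf : ¬ ∃ x, f x = none := by
      rintro ⟨x, hx⟩
      exact hN.not_gt (freeCount_pos_iff.2 ⟨x, Finset.mem_univ x, hx⟩)
    have h0 := freeCount_eq_zero (L := L) hf
    exact ⟨fun h => .of_complete hL hf (by simp [h0] at h; omega),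
      fun h => .of_complete hL hf (by simp [h0] at h; omega)⟩
  | succ N ih =>
    have hex : ∃ x, f x = none := by
      obtain ⟨x, -, hx⟩ := freeCount_pos_iff.1 (by omega : 0 < freeCount f Finset.univ)
      exact ⟨x, hx⟩
    refine ⟨fun h => ?_, fun h => .of_replies hex fun x hx => ?_⟩
    · obtain ⟨x, hx, hxL⟩ : ∃ x, f x = none ∧ (x ∈ L ∨ freeCount f L = 0) := by
        rcases Nat.eq_zero_or_pos (freeCount f L) with h0 | h0
        · exact hex.imp fun x hx => ⟨hx, .inr h0⟩
        · obtain ⟨x, hxL, hx⟩ := freeCount_pos_iff.1 h0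
          exact ⟨x, hx, .inl hxL⟩
      have hN' := freeCount_univ_update hx .skew
      refine .move hx ((ih _ (by omega)).2 ?_)
      have h1 := imbalance_update hx L .skew
      have h2 := freeCount_update hx L .skew
      simp only [charge] at h1
      split_ifs at h1 h2 with hm
      · omega
      · have := hxL.resolve_left hm
        omega
    · have hN' := freeCount_univ_update hx .split
      refine (ih _ (by omega)).1 ?_
      have h1 := imbalance_update hx L .split
      have h2 := freeCount_update hx L .split
      simp only [charge] at h1
      split_ifs at h1 h2 <;> omega

/-- If Split's surplus in `L` is at least two even after the remaining elements of `L` are shared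
alternately, beginning with Skew, then Skew keeps it so by playing outside `L` as long as possible.
With Split to move, the surplus may be one element short if nothing outside `L` is free. -/
lemma skewForces_of_excess (hL : L ∈ 𝓑) (f : Position α) :
    (2 ≤ imbalance f L - (freeCount f L % 2 : ℕ) → SkewForces 𝓑 .skew f) ∧
      (2 ≤ imbalance f L - (freeCount f L % 2 : ℕ) ∨
        (∀ x, f x = none → x ∈ L) ∧ 2 ≤ imbalance f L + (freeCount f L % 2 : ℕ) →
          SkewForces 𝓑 .split f) := by
  induction hN : freeCount f Finset.univ generalizing f with
  | zero =>
    have hf : ¬ ∃ x, f x = none := by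
      rintro ⟨x, hx⟩
      exact hN.not_gt (freeCount_pos_iff.2 ⟨x, Finset.mem_univ x, hx⟩)
    have h0 := freeCount_eq_zero (L := L) hf
    exact ⟨fun h => .of_complete hL hf (by simp [h0] at h; omega),
      fun h => .of_complete hL hf (by simp [h0] at h; omega)⟩
  | succ N ih =>
    have hex : ∃ x, f x = none := by
      obtain ⟨x, -, hx⟩ := freeCount_pos_iff.1 (by omega : 0 < freeCount f Finset.univ)
      exact ⟨x, hx⟩
    refine ⟨fun h => ?_, fun h => .of_replies hex fun x hx => ?_⟩
    · obtain ⟨x, hx, hxL⟩ : ∃ x, f x = none ∧ (x ∉ L ∨ ∀ y, f y = none → y ∈ L) := by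
        by_cases hout : ∃ y, f y = none ∧ y ∉ L
        · exact hout.imp fun x hx => ⟨hx.1, .inl hx.2⟩
        · push Not at hout
          exact hex.imp fun x hx => ⟨hx, .inr hout⟩
      have hN' := freeCount_univ_update hx .skew
      refine .move hx ((ih _ (by omega)).2 ?_)
      have h1 := imbalance_update hx L .skew
      have h2 := freeCount_update hx L .skew
      simp only [charge] at h1
      split_ifs at h1 h2 with hm
      · refine .inr ⟨fun y hy => hxL.resolve_left (not_not.2 hm) y ?_, by omega⟩
        by_cases hyx : y = x
        · rwa [hyx]
        · simpa [hyx] using hy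
      · exact .inl (by omega)
    · have hN' := freeCount_univ_update hx .split
      refine (ih _ (by omega)).1 ?_
      have h1 := imbalance_update hx L .split
      have h2 := freeCount_update hx L .split
      simp only [charge] at h1
      rcases h with h | ⟨hxL, h⟩
      · split_ifs at h1 h2 <;> omega
      · simp only [hxL x hx, if_true] at h1 h2
        omega

lemma skewForces_of_low (hL : L ∈ 𝓑) {e : ℕ} (he : L.card % 2 = e) (h : imbalance f L < -(e : ℤ)) :
    SkewForces 𝓑 .skew f := by
  refine (skewForces_of_deficit hL f).1 ?_
  have := two_dvd_card_sub f L
  omega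

lemma skewForces_of_high (hL : L ∈ 𝓑) {e : ℕ} (he : L.card % 2 = e)
    (h : 1 + (e : ℤ) < imbalance f L) : SkewForces 𝓑 .skew f := by
  refine (skewForces_of_excess hL f).1 ?_
  have := two_dvd_card_sub f L
  omega

/-- If two sets have exactly one element `x` in common, which is free, and neither can lose an element
without becoming too low, then `x` is a double threat: Skew takes it, and Split's reply restores at
most one of the two sets. -/
lemma skewForces_of_double {x : α} (hL : L ∈ 𝓑) (hM : M ∈ 𝓑) (hLM : L ∩ M = {x})
    (hx : f x = none) {e e' : ℕ} (he : L.card % 2 = e) (he' : M.card % 2 = e')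
    (hfL : imbalance f L ≤ -(e : ℤ)) (hfM : imbalance f M ≤ -(e' : ℤ)) : SkewForces 𝓑 .skew f := by
  have hxLM : x ∈ L ∩ M := hLM ▸ Finset.mem_singleton_self x
  rw [Finset.mem_inter] at hxLM
  refine .move hx ?_
  have hL' := imbalance_update hx L .skew
  have hM' := imbalance_update hx M .skew
  simp only [hxLM, if_true, charge] at hL' hM'
  set g := Function.update f x (some .skew) with hg
  by_cases hex : ∃ y, g y = none
  · refine .of_replies hex fun y hy => ?_
    have hyx : y ≠ x := by
      rintro rfl
      simp [hg] at hy
    have hyL := imbalance_update hy L .split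
    have hyM := imbalance_update hy M .split
    by_cases hmem : y ∈ L
    · have hmem' : y ∉ M := fun h =>
        hyx (Finset.mem_singleton.1 (hLM ▸ Finset.mem_inter.2 ⟨hmem, h⟩))
      refine skewForces_of_low hM he' ?_
      simp only [hmem', if_false] at hyM
      omega
    · refine skewForces_of_low hL he ?_
      simp only [hmem, if_false] at hyL
      omega
  · refine .of_complete hL hex (.inl ?_)
    have := two_dvd_card_sub g L
    have := freeCount_eq_zero (L := L) hex
    omega

end Decided

/-! ### Grids of lines inside a board -/

section Grid

variable {α : Type*} [DecidableEq α]

/-- Sets of the board `𝓑` arranged as the `p` rows and `q` columns of a grid. The numbers `er` and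
`ec` are the parities of the sizes of the rows and of the columns, which may also contain elements
outside the grid. -/
structure LineGrid (𝓑 : Finset (Finset α)) (p q er ec : ℕ) where
  row : Fin p → Finset α
  col : Fin q → Finset α
  cell : Fin p → Fin q → α
  row_mem : ∀ i, row i ∈ 𝓑
  col_mem : ∀ j, col j ∈ 𝓑
  row_card : ∀ i, (row i).card % 2 = er
  col_card : ∀ j, (col j).card % 2 = ec
  row_inj : ∀ {x i i'}, x ∈ row i → x ∈ row i' → i = i'
  col_inj : ∀ {x j j'}, x ∈ col j → x ∈ col j' → j = j'
  row_inter_col : ∀ i j, row i ∩ col j = {cell i j}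

namespace LineGrid

variable {𝓑 : Finset (Finset α)} {p q er ec : ℕ}

/-- The grid with rows and columns exchanged. -/
def transpose (G : LineGrid 𝓑 p q er ec) : LineGrid 𝓑 q p ec er where
  row := G.col
  col := G.row
  cell j i := G.cell i j
  row_mem := G.col_mem
  col_mem := G.row_mem
  row_card := G.col_card
  col_card := G.row_card
  row_inj := G.col_inj
  col_inj := G.row_inj
  row_inter_col j i := by rw [Finset.inter_comm, G.row_inter_col]

/-- The subgrid formed by a selection of rows and of columns. -/
def reindex (G : LineGrid 𝓑 p q er ec) {p' q' : ℕ} (ρ : Fin p' ↪ Fin p) (κ : Fin q' ↪ Fin q) :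
    LineGrid 𝓑 p' q' er ec where
  row i := G.row (ρ i)
  col j := G.col (κ j)
  cell i j := G.cell (ρ i) (κ j)
  row_mem _ := G.row_mem _
  col_mem _ := G.col_mem _
  row_card _ := G.row_card _
  col_card _ := G.col_card _
  row_inj h h' := ρ.injective (G.row_inj h h')
  col_inj h h' := κ.injective (G.col_inj h h')
  row_inter_col _ _ := G.row_inter_col _ _

/-- Every element of the ground set lies in a row of the grid. -/
def CoveredByRows (G : LineGrid 𝓑 p q er ec) : Prop := ∀ x, ∃ i, x ∈ G.row i

/-- Every element of the ground set lies in a column of the grid. -/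
def CoveredByCols (G : LineGrid 𝓑 p q er ec) : Prop := ∀ x, ∃ j, x ∈ G.col j

variable {G : LineGrid 𝓑 p q er ec}

lemma eq_cell_iff {x : α} {i : Fin p} {j : Fin q} :
    x = G.cell i j ↔ x ∈ G.row i ∧ x ∈ G.col j := by
  rw [← Finset.mem_inter, G.row_inter_col, Finset.mem_singleton]

lemma cell_mem_row (i : Fin p) (j : Fin q) : G.cell i j ∈ G.row i := (eq_cell_iff.1 rfl).1

lemma cell_mem_col (i : Fin p) (j : Fin q) : G.cell i j ∈ G.col j := (eq_cell_iff.1 rfl).2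

lemma CoveredByRows.reindex (h : G.CoveredByRows) {p' q' : ℕ} {ρ : Fin p' ↪ Fin p}
    {κ : Fin q' ↪ Fin q} (hρ : Function.Surjective ρ) : (G.reindex ρ κ).CoveredByRows := by
  intro x
  obtain ⟨i, hi⟩ := h x
  obtain ⟨i, rfl⟩ := hρ i
  exact ⟨i, hi⟩

lemma CoveredByCols.reindex (h : G.CoveredByCols) {p' q' : ℕ} {ρ : Fin p' ↪ Fin p}
    {κ : Fin q' ↪ Fin q} (hκ : Function.Surjective κ) : (G.reindex ρ κ).CoveredByCols := by
  intro x
  obtain ⟨j, hj⟩ := h x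
  obtain ⟨j, rfl⟩ := hκ j
  exact ⟨j, hj⟩

end LineGrid

end Grid

/-! ### Summaries of positions and searches on them -/

/-- What a position shows of a `p × q` grid of lines: the imbalance of each row and each column, and
which cells of the grid are free. -/
structure Summary (p q : ℕ) where
  row : Fin p → ℤ
  col : Fin q → ℤ
  free : Fin p → Fin q → Bool

namespace Summary

variable {p q : ℕ}

/-- The summary of the empty position. -/
def empty (p q : ℕ) : Summary p q := ⟨fun _ => 0, fun _ => 0, fun _ _ => true⟩

/-- The effect on the summary of a move of charge `s` in row `a` and column `b`, where `none` stands
for a row or a column outside the grid. -/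
def play (P : Summary p q) (a : Option (Fin p)) (b : Option (Fin q)) (s : ℤ) : Summary p q where
  row i := if a = some i then P.row i + s else P.row i
  col j := if b = some j then P.col j + s else P.col j
  free i j := P.free i j && !(decide (a = some i) && decide (b = some j))

/-- Some cell of the grid is free. -/
def hasFree (P : Summary p q) : Bool :=
  (List.finRange p).any fun i => (List.finRange q).any fun j => P.free i j

/-- With Skew to move, some line is too low or too high, or some free cell is a double threat; here
`er` and `ec` are the parities of the sizes of the rows and the columns. -/
def decided (er ec : ℕ) (P : Summary p q) : Bool :=
  (List.finRange p).any (fun i => P.row i < -(er : ℤ) || 1 + (er : ℤ) < P.row i) ||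
  (List.finRange q).any (fun j => P.col j < -(ec : ℤ) || 1 + (ec : ℤ) < P.col j) ||
  (List.finRange p).any fun i => P.row i ≤ -(er : ℤ) &&
    (List.finRange q).any fun j => P.col j ≤ -(ec : ℤ) && P.free i j

/-- The indices of the lines in one direction that may contain Split's next move, with `none` among
them if `out` allows her to play outside these lines. -/
def replies (p : ℕ) (out : Bool) : List (Option (Fin p)) :=
  (List.finRange p).map some ++ if out then [none] else []

/-- A move is illegal if it goes to an occupied cell of the grid. Whether moves outside the grid are
to free elements is not recorded. -/
def legal (P : Summary p q) : Option (Fin p) → Option (Fin q) → Bool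
  | some i, some j => P.free i j
  | _, _ => true

/-- With Split to move, the grid has a free cell, and each of her moves leads to a summary
satisfying `win`. -/
def refuted (outr outc : Bool) (win : Summary p q → Bool) (P : Summary p q) : Bool :=
  P.hasFree && (replies p outr).all fun a => (replies q outc).all fun b =>
    !P.legal a b || win (P.play a b 1)

/-- With Skew to move, he reaches a decided position, whatever Split does, by choosing his moves
from the successive lists of candidates in `guide`. -/
def skewSearch (er ec : ℕ) (outr outc : Bool) (guide : List (List (Fin p × Fin q)))
    (P : Summary p q) : Bool :=
  match guide with
  | [] => P.decided er ec
  | c :: cs => P.decided er ec || c.any fun x => P.free x.1 x.2 &&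
      (P.play (some x.1) (some x.2) (-1)).refuted outr outc (skewSearch er ec outr outc cs)

/-- Every row and every column has imbalance at most `k` in absolute value. -/
def bounded (k : ℤ) (P : Summary p q) : Bool :=
  (List.finRange p).all (fun i => -k ≤ P.row i && P.row i ≤ k) &&
    (List.finRange q).all fun j => -k ≤ P.col j && P.col j ≤ k

/-- With Split to move, `k` rounds fill a grid that contains the whole ground set, and she can keep
every line balanced in the end. The bound `2` only cuts off hopeless branches of the search. -/
def splitSearch : ℕ → Summary p q → Bool
  | 0, P => !P.hasFree && P.bounded 1
  | k + 1, P => P.bounded 2 && (List.finRange p).any fun i => (List.finRange q).any fun j =>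
      P.free i j && (P.play (some i) (some j) 1).bounded 2 &&
        (P.play (some i) (some j) 1).hasFree &&
        (List.finRange p).all fun i' => (List.finRange q).all fun j' =>
          !(P.play (some i) (some j) 1).free i' j' ||
            splitSearch k ((P.play (some i) (some j) 1).play (some i') (some j') (-1))

end Summary

section Sound

variable {α : Type*} [DecidableEq α] {𝓑 : Finset (Finset α)} {p q er ec : ℕ}
  {G : LineGrid 𝓑 p q er ec} {f : Position α} {P : Summary p q}

/-- `P` is the summary of the position `f` on the grid `G`. -/
structure Summarizes (G : LineGrid 𝓑 p q er ec) (f : Position α) (P : Summary p q) : Prop where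
  row : ∀ i, imbalance f (G.row i) = P.row i
  col : ∀ j, imbalance f (G.col j) = P.col j
  free : ∀ i j, P.free i j = true ↔ f (G.cell i j) = none

lemma summarizes_empty (G : LineGrid 𝓑 p q er ec) :
    Summarizes G (fun _ => none) (Summary.empty p q) :=
  ⟨by simp [imbalance, charge, Summary.empty], by simp [imbalance, charge, Summary.empty],
    by simp [Summary.empty]⟩

lemma Summarizes.play (h : Summarizes G f P) {x : α} (hx : f x = none) {a : Option (Fin p)}
    {b : Option (Fin q)} (ha : ∀ i, x ∈ G.row i ↔ a = some i) (hb : ∀ j, x ∈ G.col j ↔ b = some j)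
    (r : Player) :
    Summarizes G (Function.update f x (some r)) (P.play a b (charge (some r))) where
  row i := by
    rw [imbalance_update hx, h.row]
    simp only [Summary.play, ha]
    split_ifs <;> simp
  col j := by
    rw [imbalance_update hx, h.col]
    simp only [Summary.play, hb]
    split_ifs <;> simp
  free i j := by
    have hc : (a = some i ∧ b = some j) ↔ G.cell i j = x := by
      rw [← ha, ← hb, ← LineGrid.eq_cell_iff, eq_comm]
    by_cases hxc : G.cell i j = x
    · simp [Summary.play, hc.2 hxc, hxc]
    · have := hc.not.2 hxc
      rw [Function.update_of_ne hxc, ← h.free]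
      simp only [Summary.play, Bool.and_eq_true, Bool.not_eq_true', Bool.and_eq_false_iff,
        decide_eq_false_iff_not]
      tauto

lemma Summarizes.play_cell (h : Summarizes G f P) {i : Fin p} {j : Fin q}
    (hx : f (G.cell i j) = none) (r : Player) :
    Summarizes G (Function.update f (G.cell i j) (some r))
      (P.play (some i) (some j) (charge (some r))) :=
  h.play hx
    (fun _ => ⟨fun h' => congrArg some (G.row_inj (G.cell_mem_row i j) h'),
      fun h' => Option.some_injective _ h' ▸ G.cell_mem_row i j⟩)
    (fun _ => ⟨fun h' => congrArg some (G.col_inj (G.cell_mem_col i j) h'),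
      fun h' => Option.some_injective _ h' ▸ G.cell_mem_col i j⟩) r

lemma Summarizes.exists_free (h : Summarizes G f P) (hP : P.hasFree = true) : ∃ x, f x = none := by
  simp only [Summary.hasFree, List.any_eq_true, List.mem_finRange, true_and] at hP
  obtain ⟨i, j, hij⟩ := hP
  exact ⟨_, (h.free i j).1 hij⟩

lemma LineGrid.exists_row_index (G : LineGrid 𝓑 p q er ec) {out : Bool}
    (hout : out = false → G.CoveredByRows) (x : α) :
    ∃ a ∈ Summary.replies p out, ∀ i, x ∈ G.row i ↔ a = some i := by
  by_cases h : ∃ i, x ∈ G.row i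
  · obtain ⟨i, hi⟩ := h
    refine ⟨some i, by simp [Summary.replies], fun i' => ⟨fun h' => ?_, fun h' => ?_⟩⟩
    · exact congrArg some (G.row_inj hi h')
    · exact Option.some_injective _ h' ▸ hi
  · cases out with
    | false => exact absurd (hout rfl x) h
    | true =>
      push Not at h
      exact ⟨none, by simp [Summary.replies], fun i => by simp [h i]⟩

lemma LineGrid.exists_col_index (G : LineGrid 𝓑 p q er ec) {out : Bool}
    (hout : out = false → G.CoveredByCols) (x : α) :
    ∃ b ∈ Summary.replies q out, ∀ j, x ∈ G.col j ↔ b = some j :=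
  G.transpose.exists_row_index hout x

lemma Summarizes.splitForces_of_splitSearch (hr : G.CoveredByRows) (hc : G.CoveredByCols)
    (hB : ∀ L ∈ 𝓑, (∃ i, L = G.row i) ∨ ∃ j, L = G.col j) (k : ℕ) (h : Summarizes G f P)
    (hP : P.splitSearch k = true) : Forces .split (Balanced 𝓑) .split f := by
  have hcell : ∀ x, ∃ i j, x = G.cell i j := fun x => by
    obtain ⟨i, hi⟩ := hr x
    obtain ⟨j, hj⟩ := hc x
    exact ⟨i, j, LineGrid.eq_cell_iff.2 ⟨hi, hj⟩⟩
  induction k generalizing f P with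
  | zero =>
    simp only [Summary.splitSearch, Summary.hasFree, Summary.bounded, Bool.and_eq_true,
      Bool.not_eq_true', List.any_eq_false, List.all_eq_true, List.mem_finRange, forall_true_left,
      decide_eq_true_eq, ← h.row, ← h.col, h.free, List.any_eq_true, true_and, not_exists] at hP
    refine .done (fun x => ?_) fun L hL => ?_
    · obtain ⟨i, j, rfl⟩ := hcell x
      exact hP.1 i j
    · rcases hB L hL with ⟨i, rfl⟩ | ⟨j, rfl⟩
      · exact abs_le.2 (hP.2.1 i)
      · exact abs_le.2 (hP.2.2 j)
  | succ k ih =>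
    simp only [Summary.splitSearch, Bool.and_eq_true, List.any_eq_true, List.all_eq_true,
      List.mem_finRange, forall_true_left, true_and, Bool.or_eq_true, Bool.not_eq_true'] at hP
    obtain ⟨-, i, j, ⟨⟨hij, -⟩, hfree⟩, hrep⟩ := hP
    have hx := (h.free i j).1 hij
    have h' := h.play_cell hx .split
    refine .own _ hx (.opp (p := .split) (h'.exists_free hfree) fun y hy => ?_)
    obtain ⟨i', j', rfl⟩ := hcell y
    refine ih (h'.play_cell hy .skew) ((hrep i' j').resolve_left ?_)
    have := (h'.free i' j').2 hy
    simpa [charge] using this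

variable [Fintype α]

lemma Summarizes.skewForces_of_decided (h : Summarizes G f P) (hP : P.decided er ec = true) :
    SkewForces 𝓑 .skew f := by
  simp only [Summary.decided, Bool.or_eq_true, List.any_eq_true, List.mem_finRange, true_and,
    decide_eq_true_eq, Bool.and_eq_true, ← h.row, ← h.col, h.free] at hP
  rcases hP with (⟨i, hi⟩ | ⟨j, hj⟩) | ⟨i, hi, j, hj, hij⟩
  · exact hi.elim (skewForces_of_low (G.row_mem i) (G.row_card i))
      (skewForces_of_high (G.row_mem i) (G.row_card i))
  · exact hj.elim (skewForces_of_low (G.col_mem j) (G.col_card j))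
      (skewForces_of_high (G.col_mem j) (G.col_card j))
  · exact skewForces_of_double (G.row_mem i) (G.col_mem j) (G.row_inter_col i j) hij
      (G.row_card i) (G.col_card j) hi hj

lemma Summarizes.skewForces_of_skewSearch {outr outc : Bool} {guide : List (List (Fin p × Fin q))}
    (hr : outr = false → G.CoveredByRows) (hc : outc = false → G.CoveredByCols)
    (h : Summarizes G f P) (hP : P.skewSearch er ec outr outc guide = true) :
    SkewForces 𝓑 .skew f := by
  induction guide generalizing f P with
  | nil => exact h.skewForces_of_decided hP
  | cons c cs ih =>
    simp only [Summary.skewSearch, Bool.or_eq_true, List.any_eq_true, Bool.and_eq_true,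
      Summary.refuted, List.all_eq_true, Bool.not_eq_true', Prod.exists] at hP
    rcases hP with hP | ⟨i, j, -, hij, hfree, hrep⟩
    · exact h.skewForces_of_decided hP
    · have hx := (h.free i j).1 hij
      have h' := h.play_cell hx .skew
      refine .move hx (.of_replies (h'.exists_free hfree) fun y hy => ?_)
      obtain ⟨a, ha, hya⟩ := G.exists_row_index hr y
      obtain ⟨b, hb, hyb⟩ := G.exists_col_index hc y
      refine ih (h'.play hy hya hyb .split) ((hrep a ha b hb).resolve_left ?_)
      cases a with
      | none => simp [Summary.legal]
      | some i' =>
        cases b with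
        | none => simp [Summary.legal]
        | some j' =>
          have hyc : y = G.cell i' j' :=
            LineGrid.eq_cell_iff.2 ⟨(hya i').2 rfl, (hyb j').2 rfl⟩
          have := (h'.free i' j').2 (hyc ▸ hy)
          simpa [Summary.legal, charge] using this

end Sound

/-! ### The game on grids -/

section Embeddings

lemma exists_embedding_avoiding {p m : ℕ} (h : p + 1 ≤ m) (i₀ : Fin m) :
    ∃ ρ : Fin p ↪ Fin m, ∀ i, ρ i ≠ i₀ := by
  obtain ⟨m, rfl⟩ : ∃ k, m = k + 1 := ⟨m - 1, by omega⟩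
  exact ⟨(Fin.castLEEmb (by omega)).trans i₀.succAboveEmb, fun i => Fin.succAbove_ne i₀ _⟩

lemma exists_embedding_zero {p m : ℕ} [NeZero p] (h : p ≤ m) (i₀ : Fin m) :
    ∃ ρ : Fin p ↪ Fin m, ρ 0 = i₀ :=
  ⟨(Fin.castLEEmb h).trans (Equiv.swap (Fin.castLE h 0) i₀).toEmbedding, by simp⟩

end Embeddings

section Searches

open Summary

lemma skewSearch_even_even : (empty 1 1).skewSearch 0 0 true true [] = true := by decide +kernel

lemma skewSearch_even_odd : (empty 2 1).skewSearch 0 1 true true [[(0, 0)]] = true := by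
  decide +kernel

/-- On four rows and three columns of a larger grid with odd lines, Skew, moving first, decides the
game with three moves. -/
lemma skewSearch_odd_odd :
    (empty 4 3).skewSearch 1 1 true true
      [[(0, 0)], [(1, 1), (2, 2), (2, 0), (3, 0)],
        [(0, 1), (1, 2), (1, 1), (3, 2), (3, 1), (2, 2)]] = true := by
  decide +kernel

/-- On five rows of a grid with three columns, in which Split has made a first move, Skew decides
the game with five moves. -/
lemma skewSearch_three_columns :
    ((empty 5 3).play (some 0) (some 0) 1).skewSearch 1 1 true false
      [[(1, 1)], [(1, 2), (2, 1)], [(2, 1), (2, 2), (3, 1), (3, 2), (4, 1)],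
        [(2, 2), (2, 1), (3, 1), (3, 2), (4, 2)], [(2, 2)]] = true := by
  decide +kernel

lemma skewSearch_three_three :
    ((empty 3 3).play (some 0) (some 0) 1).skewSearch 1 1 false false
      [[(1, 1)], [(1, 2), (0, 1)], [(1, 0), (2, 1), (2, 2)], [(0, 2), (2, 0)]] = true := by
  decide +kernel

lemma splitSearch_three_three :
    ((empty 3 3).play (some 0) (some 0) (-1)).splitSearch 4 = true := by
  decide +kernel

end Searches

section Grids

variable {α : Type*} [DecidableEq α] {𝓑 : Finset (Finset α)} {m n er ec : ℕ}

/-- After a first move at the element `x`, a grid with at least `p` rows and `q` columns has a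
`p × q` subgrid whose corner is `x`. -/
lemma LineGrid.exists_summarizes_corner (G : LineGrid 𝓑 m n er ec) (hr : G.CoveredByRows)
    (hc : G.CoveredByCols) {p q : ℕ} [NeZero p] [NeZero q] (hp : p ≤ m) (hq : q ≤ n) (x : α)
    (r : Player) :
    ∃ (ρ : Fin p ↪ Fin m) (κ : Fin q ↪ Fin n),
      Summarizes (G.reindex ρ κ) (Function.update (fun _ => none) x (some r))
        ((Summary.empty p q).play (some 0) (some 0) (charge (some r))) := by
  obtain ⟨i, hi⟩ := hr x
  obtain ⟨j, hj⟩ := hc x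
  obtain ⟨ρ, hρ⟩ := exists_embedding_zero hp i
  obtain ⟨κ, hκ⟩ := exists_embedding_zero hq j
  have hx : x = (G.reindex ρ κ).cell 0 0 :=
    LineGrid.eq_cell_iff.2 ⟨by simpa [reindex, hρ] using hi, by simpa [reindex, hκ] using hj⟩
  subst hx
  exact ⟨ρ, κ, (summarizes_empty _).play_cell rfl r⟩

lemma LineGrid.splitForces_three_three [Nonempty α] (G : LineGrid 𝓑 3 3 1 1) (hr : G.CoveredByRows)
    (hc : G.CoveredByCols) (hB : ∀ L ∈ 𝓑, (∃ i, L = G.row i) ∨ ∃ j, L = G.col j) :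
    Forces .split (Balanced 𝓑) .skew fun _ => none := by
  refine .opp (p := .split) ⟨Classical.arbitrary α, rfl⟩ fun x _ => ?_
  obtain ⟨ρ, κ, h⟩ := G.exists_summarizes_corner hr hc le_rfl le_rfl x .skew
  have hρ := Finite.injective_iff_surjective.1 ρ.injective
  have hκ := Finite.injective_iff_surjective.1 κ.injective
  refine h.splitForces_of_splitSearch (hr.reindex hρ) (hc.reindex hκ) (fun L hL => ?_) 4
    splitSearch_three_three
  rcases hB L hL with ⟨i, rfl⟩ | ⟨j, rfl⟩
  · obtain ⟨i, rfl⟩ := hρ i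
    exact .inl ⟨i, rfl⟩
  · obtain ⟨j, rfl⟩ := hκ j
    exact .inr ⟨j, rfl⟩

variable [Fintype α]

lemma LineGrid.skewForces_skew (G : LineGrid 𝓑 m n er ec) {p q : ℕ}
    {guide : List (List (Fin p × Fin q))} (hp : p ≤ m) (hq : q ≤ n)
    (h : (Summary.empty p q).skewSearch er ec true true guide = true) :
    SkewForces 𝓑 .skew fun _ => none :=
  (summarizes_empty (G.reindex (Fin.castLEEmb hp) (Fin.castLEEmb hq))).skewForces_of_skewSearch
    (outr := true) (outc := true) nofun nofun h

variable [Nonempty α]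

/-- If Skew wins by moving first on a `p × q` subgrid, then he wins in either role on a grid with
one more row and column, by avoiding the row and the column of Split's first move. -/
lemma LineGrid.skewForces (G : LineGrid 𝓑 m n er ec) (hr : G.CoveredByRows)
    (hc : G.CoveredByCols) {p q : ℕ} {guide : List (List (Fin p × Fin q))} (hp : p + 1 ≤ m)
    (hq : q + 1 ≤ n) (h : (Summary.empty p q).skewSearch er ec true true guide = true) :
    ∀ t, SkewForces 𝓑 t fun _ => none
  | .skew => G.skewForces_skew (by omega) (by omega) h
  | .split => by
    refine .of_replies ⟨Classical.arbitrary α, rfl⟩ fun x _ => ?_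
    obtain ⟨i, hi⟩ := hr x
    obtain ⟨j, hj⟩ := hc x
    obtain ⟨ρ, hρ⟩ := exists_embedding_avoiding hp i
    obtain ⟨κ, hκ⟩ := exists_embedding_avoiding hq j
    have hs := (summarizes_empty (G.reindex ρ κ)).play (x := x) (a := none) (b := none) rfl
      (fun i' => iff_of_false (fun h' => hρ i' (G.row_inj h' hi)) nofun)
      (fun j' => iff_of_false (fun h' => hκ j' (G.col_inj h' hj)) nofun) .split
    exact hs.skewForces_of_skewSearch (outr := true) (outc := true) (guide := guide) nofun nofun
      (by simpa [Summary.play, Summary.empty] using h)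

/-- The case of odd lines: the only grid with more than three rows that is too narrow for avoiding
Split's first move has three columns. -/
lemma LineGrid.skewForces_of_odd (G : LineGrid 𝓑 m n 1 1) (hr : G.CoveredByRows)
    (hc : G.CoveredByCols) (hm : 5 ≤ m) (hn : 3 ≤ n) (t : Player) :
    SkewForces 𝓑 t fun _ => none := by
  rcases hn.eq_or_lt with rfl | hn
  · cases t with
    | skew => exact G.skewForces_skew (by omega) le_rfl skewSearch_odd_odd
    | split =>
      refine .of_replies ⟨Classical.arbitrary α, rfl⟩ fun x _ => ?_
      obtain ⟨ρ, κ, h⟩ := G.exists_summarizes_corner hr hc hm le_rfl x .split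
      exact h.skewForces_of_skewSearch (outr := true) (outc := false) nofun
        (fun _ => hc.reindex (Finite.injective_iff_surjective.1 κ.injective))
        skewSearch_three_columns
  · exact G.skewForces hr hc (by omega) hn skewSearch_odd_odd t

lemma LineGrid.skewForces_three_three (G : LineGrid 𝓑 3 3 1 1) (hr : G.CoveredByRows)
    (hc : G.CoveredByCols) : SkewForces 𝓑 .split fun _ => none := by
  refine .of_replies ⟨Classical.arbitrary α, rfl⟩ fun x _ => ?_
  obtain ⟨ρ, κ, h⟩ := G.exists_summarizes_corner hr hc le_rfl le_rfl x .split
  exact h.skewForces_of_skewSearch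
    (fun _ => hr.reindex (Finite.injective_iff_surjective.1 ρ.injective))
    (fun _ => hc.reindex (Finite.injective_iff_surjective.1 κ.injective)) skewSearch_three_three

end Grids

section TicTacToe

variable (m n : ℕ)

lemma card_row (i : Fin m) : (row m n i).card = n := by
  have : row m n i = {i} ×ˢ Finset.univ := by ext ⟨a, b⟩; simp [row, eq_comm]
  simp [this]

lemma card_column (j : Fin n) : (column m n j).card = m := by
  have : column m n j = Finset.univ ×ˢ {j} := by ext ⟨a, b⟩; simp [column, eq_comm]
  simp [this]

variable {m n} {er ec : ℕ}

/-- All rows and columns of the `m × n` board. -/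
def ticTacToeGrid (hn : n % 2 = er) (hm : m % 2 = ec) :
    LineGrid (ticTacToeBoard m n) m n er ec where
  row := row m n
  col := column m n
  cell i j := (i, j)
  row_mem i := by simp [ticTacToeBoard]
  col_mem j := by simp [ticTacToeBoard]
  row_card i := by rw [card_row, hn]
  col_card j := by rw [card_column, hm]
  row_inj h h' := by simp_all [row]
  col_inj h h' := by simp_all [column]
  row_inter_col i j := by ext ⟨a, b⟩; simp [row, column]

lemma ticTacToeGrid_coveredByRows (hn : n % 2 = er) (hm : m % 2 = ec) :
    (ticTacToeGrid hn hm).CoveredByRows := fun x => ⟨x.1, by simp [ticTacToeGrid, row]⟩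

lemma ticTacToeGrid_coveredByCols (hn : n % 2 = er) (hm : m % 2 = ec) :
    (ticTacToeGrid hn hm).CoveredByCols := fun x => ⟨x.2, by simp [ticTacToeGrid, column]⟩

lemma skewForces_ticTacToe (hm : 2 ≤ m) (hn : 2 ≤ n) (h : ¬ (m = 3 ∧ n = 3)) (t : Player) :
    SkewForces (ticTacToeBoard m n) t fun _ => none := by
  have : Nonempty (Fin m × Fin n) := ⟨(⟨0, by omega⟩, ⟨0, by omega⟩)⟩
  rcases Nat.mod_two_eq_zero_or_one m with h2m | h2m <;>
    rcases Nat.mod_two_eq_zero_or_one n with h2n | h2n <;>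
    have hr := ticTacToeGrid_coveredByRows h2n h2m <;>
    have hc := ticTacToeGrid_coveredByCols h2n h2m
  · exact LineGrid.skewForces _ hr hc hm hn skewSearch_even_even t
  · exact (ticTacToeGrid h2n h2m).transpose.skewForces hc hr (by omega) hm skewSearch_even_odd t
  · exact LineGrid.skewForces _ hr hc (by omega) hn skewSearch_even_odd t
  · by_cases hm5 : 5 ≤ m
    · exact LineGrid.skewForces_of_odd _ hr hc hm5 (by omega) t
    · exact (ticTacToeGrid h2n h2m).transpose.skewForces_of_odd hc hr (by omega) (by omega) t

lemma hasWinningStrategy_three_three (t : Player) :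
    HasWinningStrategy (ticTacToeBoard 3 3) t t.other := by
  have hr := ticTacToeGrid_coveredByRows (m := 3) (n := 3) rfl rfl
  have hc := ticTacToeGrid_coveredByCols (m := 3) (n := 3) rfl rfl
  cases t with
  | split => exact hasWinningStrategy_skew (LineGrid.skewForces_three_three _ hr hc)
  | skew =>
    refine hasWinningStrategy_split (LineGrid.splitForces_three_three _ hr hc fun L hL => ?_)
    simpa [ticTacToeBoard, ticTacToeGrid, eq_comm] using hL

end TicTacToe

end SplittingGame

theorem mainTheorem6 (m n : ℕ) (hm : 2 ≤ m) (hn : 2 ≤ n) :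
    (m = 3 ∧ n = 3 → ∀ t : SplittingGame.Player,
      SplittingGame.HasWinningStrategy (SplittingGame.ticTacToeBoard m n) t t.other) ∧
    (¬ (m = 3 ∧ n = 3) → ∀ t : SplittingGame.Player,
      SplittingGame.HasWinningStrategy (SplittingGame.ticTacToeBoard m n) t
        SplittingGame.Player.skew) := by
  have : Nonempty (Fin m × Fin n) := ⟨(⟨0, by omega⟩, ⟨0, by omega⟩)⟩
  refine ⟨?_, fun h t => SplittingGame.hasWinningStrategy_skew
    (SplittingGame.skewForces_ticTacToe hm hn h t)⟩
  rintro ⟨rfl, rfl⟩ t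
  exact SplittingGame.hasWinningStrategy_three_three t
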